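/- Let $G$ be a finite group. A $G$-Tambara functor $T$ consists of commutative rings $T(G/H)$ for $H\le G$, with restrictions (ring homomorphisms) $r^H_K\colon T(G/H)\to T(G/K)$, transfers (additive maps) $t^H_K\colon T(G/K)\to T(G/H)$ and norms (multiplicative unital maps) $N^H_K\colon T(G/K)\to T(G/H)$ for $K\le H$, and conjugation isomorphisms $c_{g,H}\colon T(G/H)\to T(G/gHg^{-1})$, satisfying the usual axioms (functoriality, compatibility with conjugation, additive and multiplicative double coset formulas, Frobenius reciprocity, Tambara reciprocity for sums and transfers). A morphism $\varphi\colon T\to S$ is a family of ring homomorphisms $\varphi_H\colon T(G/H)\to S(G/H)$ commuting with all structure maps. A Tambara ideal $I\trianglelefteq T$ is a family of ring ideals $I(G/H)\subseteq T(G/H)$ closed under restriction, transfer, norm and conjugation; inclusion and intersection are levelwise, and $IJ$ is the smallest Tambara ideal containing all $I(G/H)J(G/H)$. For $x\in T(G/H)$ let $\langle x\rangle$ be the smallest Tambara ideal containing $x$. The radical of $I$ is given by $\sqrt I(G/H)=\{x\in T(G/H) : \langle x\rangle^n\subseteq I\text{ for some }n\ge1\}$, and $I$ is radical if $I=\sqrt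 I$. A Tambara ideal $P$ is prime if $1\notin P(G/G)$ and, for all Tambara ideals $I,J$, $IJ\subseteq P$ implies $I\subseteq P$ or $J\subseteq P$. Let $\mathrm{RadId}_G(T)$ be the set of radical Tambara ideals ordered by inclusion, and let $\mathrm{Spec}_{\mathbf{Nak}}(T)$ be the set of prime Tambara ideals, with the topology for which the sets $\{P : x\in P(G/H)\}$ ($H\le G$, $x\in T(G/H)$) form a subbasis of the closed sets. For a frame $A$, let $\mathrm{pt}(A)$ be the space of frame homomorphisms $p\colon A\to\{0<1\}$ with open sets $\{p : p(a)=1\}$, $a\in A$. Let $\varphi\colon T\to S$ be a morphism of $G$-Tambara functors, and for $I\trianglelefteq T$ let $\varphi_*(I)\trianglelefteq S$ be the Tambara ideal generated by the subsets $\varphi_H(I(G/H))$, $H\le G$. Then $\mathrm{RadId}_G(T)$ and $\mathrm{RadId}_G(S)$ are frames, $\mathrm{Spec}_{\mathbf{Nak}}(T)$ and $\mathrm{Spec}_{\mathbf{Nak}}(S)$ are spectral spaces, and the following hold. 1. The assignment $\widetilde\varphi(I)=\sqrt{\varphi_*(I)}$ is a well-defined frame homomorphism $\widetilde\varphi\colon\mathrm{RadId}_G(T)\to\mathrm{RadId}_G(S)$.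 2. There are homeomorphisms $e_T\colon\mathrm{Spec}_{\mathbf{Nak}}(T)\cong\mathrm{pt}(\mathrm{RadId}_G(T))$ and $e_S\colon\mathrm{Spec}_{\mathbf{Nak}}(S)\cong\mathrm{pt}(\mathrm{RadId}_G(S))$, under which a prime $P$ corresponds to the point $p$ with $p(I)=1$ if and only if $I\not\subseteq P$; and the map $\varphi^a\colon\mathrm{Spec}_{\mathbf{Nak}}(S)\to\mathrm{Spec}_{\mathbf{Nak}}(T)$ induced by $\widetilde\varphi$, that is, the map with $e_T(\varphi^a(Q))=e_S(Q)\circ\widetilde\varphi$ for all $Q$, is spectral (continuous, and preimages of compact open sets are compact). 3. For every prime $Q$ of $S$, $\varphi^a(Q)$ is the levelwise preimage $\varphi^{-1}(Q)$, given by $\varphi^{-1}(Q)(G/H)=\varphi_H^{-1}(Q(G/H))$. -/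

import Mathlib

/-! Tambara functors for a finite group, their ideals, radicals and Nakaoka spectrum. -/

section Groups

variable {G : Type*} [Group G]

/-- The conjugate subgroup `g H g⁻¹`. -/
def conjBy (g : G) (H : Subgroup G) : Subgroup G :=
  H.map (MulAut.conj g).toMonoidHom

/-- `L \ K / H` for subgroups `L`, `H` of `K`; the representative `q.out` is an element of `K`. -/
abbrev DoubleCosets (L K H : Subgroup G) : Type _ :=
  DoubleCoset.Quotient ((L.subgroupOf K : Subgroup K) : Set K) ((H.subgroupOf K : Subgroup K) : Set K)

/-- The chosen representative in `G` of a double coset in `L \ K / H`. -/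
noncomputable def DoubleCosets.rep {L K H : Subgroup G} (q : DoubleCosets L K H) : K :=
  Quotient.out q

/-- The set `Map(K/H, {a, b})`; the value `true` stands for the label `a`, `false` for `b`. -/
def CosetColoring (H K : Subgroup G) : Type _ := (K ⧸ H.subgroupOf K) → Bool

/-- `K` acts on `Map(K/H, {a, b})` by `(k • f)(y) = f (k⁻¹ y)`. -/
instance (H K : Subgroup G) : MulAction K (CosetColoring H K) where
  smul k f := fun y => f (k⁻¹ • y)
  one_smul f := by
    funext y
    change f ((1 : K)⁻¹ • y) = f y
    simp
  mul_smul k l f := by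
    funext y
    change f ((k * l)⁻¹ • y) = f (l⁻¹ • k⁻¹ • y)
    rw [mul_inv_rev, mul_smul]

/-- The projection `K/L → K/H` for `L ≤ H`. -/
def cosetProj {L H : Subgroup G} (h : L ≤ H) (K : Subgroup G) :
    (K ⧸ L.subgroupOf K) → (K ⧸ H.subgroupOf K) :=
  Subgroup.quotientMapOfLE (Subgroup.comap_mono h)

theorem cosetProj_smul {L H : Subgroup G} (h : L ≤ H) (K : Subgroup G) (k : K)
    (y : K ⧸ L.subgroupOf K) : cosetProj h K (k • y) = k • cosetProj h K y := by
  induction y using QuotientGroup.induction_on with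
  | H z => rfl

/-- The set of sections of the projection `K/L → K/H`. -/
def CosetSection {L H : Subgroup G} (h : L ≤ H) (K : Subgroup G) : Type _ :=
  {s : (K ⧸ H.subgroupOf K) → (K ⧸ L.subgroupOf K) // ∀ y, cosetProj h K (s y) = y}

/-- `K` acts on sections of `K/L → K/H` by `(k • s)(y) = k s(k⁻¹ y)`. -/
instance {L H : Subgroup G} (h : L ≤ H) (K : Subgroup G) : MulAction K (CosetSection h K) where
  smul k s := ⟨fun y => k • s.1 (k⁻¹ • y), fun y => by
    rw [cosetProj_smul, s.2, smul_inv_smul]⟩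
  one_smul s := by
    apply Subtype.ext
    funext y
    change (1 : K) • s.1 ((1 : K)⁻¹ • y) = s.1 y
    simp
  mul_smul k l s := by
    apply Subtype.ext
    funext y
    change (k * l) • s.1 ((k * l)⁻¹ • y) = k • l • s.1 (l⁻¹ • k⁻¹ • y)
    rw [mul_inv_rev, mul_smul, mul_smul]

/-- The stabilizer in `K` of a point of a `K`-set, as a subgroup of `G`. -/
def stabIn (K : Subgroup G) {X : Type*} [MulAction K X] (x : X) : Subgroup G :=
  (MulAction.stabilizer K x).map K.subtype

theorem stabIn_le (K : Subgroup G) {X : Type*} [MulAction K X] (x : X) : stabIn K x ≤ K := by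
  rintro _ ⟨k, -, rfl⟩
  exact k.2

/-- An element of `K` whose coset is the value at `γ H` of a section `s` of `K/L → K/H`. -/
noncomputable def CosetSection.lift {L H : Subgroup G} {h : L ≤ H} {K : Subgroup G}
    (s : CosetSection h K) (γ : K) : K :=
  Quotient.out (s.1 (QuotientGroup.mk γ))

theorem CosetSection.stab_inf_le {L H : Subgroup G} {h : L ≤ H} {K : Subgroup G}
    (s : CosetSection h K) (γ : K) :
    stabIn K s ⊓ conjBy (γ : G) H ≤ conjBy ((s.lift γ : K) : G) L := by
  rintro x ⟨⟨k, hk, rfl⟩, ⟨z, hz, hzk⟩⟩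
  have hzk' : (γ : G) * z * (γ : G)⁻¹ = k := hzk
  have e1 : k • s.1 (k⁻¹ • (QuotientGroup.mk γ : K ⧸ H.subgroupOf K)) =
      s.1 (QuotientGroup.mk γ) :=
    congrFun (congrArg (fun t : CosetSection h K => t.1) (MulAction.mem_stabilizer_iff.1 hk)) (QuotientGroup.mk γ)
  have e2 : k⁻¹ • (QuotientGroup.mk γ : K ⧸ H.subgroupOf K) = QuotientGroup.mk γ := by
    change (QuotientGroup.mk (k⁻¹ * γ) : K ⧸ H.subgroupOf K) = QuotientGroup.mk γ
    rw [QuotientGroup.eq, Subgroup.mem_subgroupOf]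
    have : (((k⁻¹ * γ)⁻¹ * γ : K) : G) = z := by
      simp only [Subgroup.coe_mul, Subgroup.coe_inv, ← hzk']
      group
    rw [this]
    exact hz
  rw [e2] at e1
  have e3 : (QuotientGroup.mk (s.lift γ) : K ⧸ L.subgroupOf K) = s.1 (QuotientGroup.mk γ) :=
    Quotient.out_eq' _
  rw [← e3] at e1
  have e4 : (QuotientGroup.mk (s.lift γ) : K ⧸ L.subgroupOf K) =
      QuotientGroup.mk (k * s.lift γ) := e1.symm
  rw [QuotientGroup.eq, Subgroup.mem_subgroupOf] at e4
  refine ⟨_, e4, ?_⟩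
  change ((s.lift γ : K) : G) * (((s.lift γ)⁻¹ * (k * s.lift γ) : K) : G) *
    ((s.lift γ : K) : G)⁻¹ = (k : G)
  simp only [Subgroup.coe_mul, Subgroup.coe_inv]
  group

end Groups

universe u v w

/-- The data of a `G`-Tambara functor: `obj H` is `T(G/H)`, and `res`, `tr`, `nm` and `conj g` are
restriction, transfer, norm and conjugation. The target of `conj g` on `T(G/H)` is
`T(G/K)`, where `K` is a subgroup with a proof of `K = g H g⁻¹`. -/
structure TambaraData (G : Type u) [Group G] where
  obj : Subgroup G → Type v
  [commRing : ∀ H, CommRing (obj H)]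
  res : ∀ {K H : Subgroup G}, K ≤ H → (obj H →+* obj K)
  tr : ∀ {K H : Subgroup G}, K ≤ H → (obj K →+ obj H)
  nm : ∀ {K H : Subgroup G}, K ≤ H → (obj K →* obj H)
  conj : ∀ (g : G) {H K : Subgroup G}, K = conjBy g H → (obj H ≃+* obj K)

attribute [instance] TambaraData.commRing

/-- A `G`-Tambara functor (for a finite group `G`). -/
structure TambaraFunctor (G : Type u) [Group G] extends TambaraData.{u, v} G where
  -- functoriality
  res_id : ∀ (H : Subgroup G) (x : obj H), res (le_refl H) x = x
  tr_id : ∀ (H : Subgroup G) (x : obj H), tr (le_refl H) x = x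
  nm_id : ∀ (H : Subgroup G) (x : obj H), nm (le_refl H) x = x
  conj_id : ∀ (H : Subgroup G) (g : G) (_ : g ∈ H) (h : H = conjBy g H) (x : obj H),
    conj g h x = x
  res_res : ∀ {L K H : Subgroup G} (hLK : L ≤ K) (hKH : K ≤ H) (x : obj H),
    res hLK (res hKH x) = res (hLK.trans hKH) x
  tr_tr : ∀ {L K H : Subgroup G} (hLK : L ≤ K) (hKH : K ≤ H) (x : obj L),
    tr hKH (tr hLK x) = tr (hLK.trans hKH) x
  nm_nm : ∀ {L K H : Subgroup G} (hLK : L ≤ K) (hKH : K ≤ H) (x : obj L),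
    nm hKH (nm hLK x) = nm (hLK.trans hKH) x
  conj_conj : ∀ (g k : G) {H K L : Subgroup G} (hK : K = conjBy k H) (hL : L = conjBy g K)
    (hL' : L = conjBy (g * k) H) (x : obj H), conj g hL (conj k hK x) = conj (g * k) hL' x
  -- conjugacy compatibility
  conj_res : ∀ (g : G) {K H K' H' : Subgroup G} (h : K ≤ H) (h' : K' ≤ H')
    (hK : K' = conjBy g K) (hH : H' = conjBy g H) (x : obj H),
    conj g hK (res h x) = res h' (conj g hH x)
  conj_tr : ∀ (g : G) {K H K' H' : Subgroup G} (h : K ≤ H) (h' : K' ≤ H')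
    (hK : K' = conjBy g K) (hH : H' = conjBy g H) (x : obj K),
    conj g hH (tr h x) = tr h' (conj g hK x)
  conj_nm : ∀ (g : G) {K H K' H' : Subgroup G} (h : K ≤ H) (h' : K' ≤ H')
    (hK : K' = conjBy g K) (hH : H' = conjBy g H) (x : obj K),
    conj g hH (nm h x) = nm h' (conj g hK x)
  -- additive and multiplicative double coset formulas
  res_tr : ∀ {H L K : Subgroup G} (hH : H ≤ K) (hL : L ≤ K) (a : obj H),
    res hL (tr hH a) = ∑ᶠ q : DoubleCosets L K H,
      tr (inf_le_left : L ⊓ conjBy (q.rep : G) H ≤ L)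
        (res (inf_le_right : L ⊓ conjBy (q.rep : G) H ≤ conjBy (q.rep : G) H)
          (conj (q.rep : G) rfl a))
  res_nm : ∀ {H L K : Subgroup G} (hH : H ≤ K) (hL : L ≤ K) (a : obj H),
    res hL (nm hH a) = ∏ᶠ q : DoubleCosets L K H,
      nm (inf_le_left : L ⊓ conjBy (q.rep : G) H ≤ L)
        (res (inf_le_right : L ⊓ conjBy (q.rep : G) H ≤ conjBy (q.rep : G) H)
          (conj (q.rep : G) rfl a))
  -- Frobenius reciprocity
  frobenius : ∀ {K H : Subgroup G} (h : K ≤ H) (x : obj H) (y : obj K),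
    tr h (res h x * y) = x * tr h y
  -- Tambara reciprocity for sums: the sum is over the `K`-orbits of maps `f : K/H → {a, b}`;
  -- with `S` the stabilizer of `f`, the product is over `S \ K / H`
  nm_add : ∀ {H K : Subgroup G} (h : H ≤ K) (a b : obj H),
    nm h (a + b) = ∑ᶠ o : MulAction.orbitRel.Quotient K (CosetColoring H K),
      tr (stabIn_le K (Quotient.out o)) (∏ᶠ q : DoubleCosets (stabIn K (Quotient.out o)) K H,
        nm (inf_le_left : stabIn K (Quotient.out o) ⊓ conjBy (q.rep : G) H ≤ _)
          (res (inf_le_right : stabIn K (Quotient.out o) ⊓ conjBy (q.rep : G) H ≤ _)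
            (conj (q.rep : G) rfl
              (bif (Quotient.out o : CosetColoring H K) (QuotientGroup.mk q.rep) then a else b))))
  -- Tambara reciprocity for transfers: the sum is over the `K`-orbits of sections `s` of
  -- `K/L → K/H`; with `S` the stabilizer of `s`, the product is over `[γ] ∈ S \ K / H`, and
  -- `s.lift γ` is an element `δ` of `K` with `s (γ H) = δ L`
  nm_tr : ∀ {L H K : Subgroup G} (hLH : L ≤ H) (hHK : H ≤ K) (x : obj L),
    nm hHK (tr hLH x) = ∑ᶠ o : MulAction.orbitRel.Quotient K (CosetSection hLH K),
      tr (stabIn_le K (Quotient.out o)) (∏ᶠ q : DoubleCosets (stabIn K (Quotient.out o)) K H,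
        nm (inf_le_left : stabIn K (Quotient.out o) ⊓ conjBy (q.rep : G) H ≤ _)
          (res (CosetSection.stab_inf_le (Quotient.out o) q.rep)
            (conj ((CosetSection.lift (Quotient.out o) q.rep : K) : G) rfl x)))

/-- A morphism of `G`-Tambara functors. -/
structure TambaraHom {G : Type u} [Group G] (T : TambaraFunctor.{u, v} G)
    (S : TambaraFunctor.{u, w} G) where
  app : ∀ H : Subgroup G, T.obj H →+* S.obj H
  app_res : ∀ {K H : Subgroup G} (h : K ≤ H) (x : T.obj H),
    app K (T.res h x) = S.res h (app H x)
  app_tr : ∀ {K H : Subgroup G} (h : K ≤ H) (x : T.obj K),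
    app H (T.tr h x) = S.tr h (app K x)
  app_nm : ∀ {K H : Subgroup G} (h : K ≤ H) (x : T.obj K),
    app H (T.nm h x) = S.nm h (app K x)
  app_conj : ∀ (g : G) {H K : Subgroup G} (h : K = conjBy g H) (x : T.obj H),
    app K (T.conj g h x) = S.conj g h (app H x)

/-- A Tambara ideal of `T`. -/
@[ext]
structure TambaraIdeal {G : Type u} [Group G] (T : TambaraFunctor.{u, v} G) where
  level : ∀ H : Subgroup G, Ideal (T.obj H)
  res_mem : ∀ {K H : Subgroup G} (h : K ≤ H) (x : T.obj H), x ∈ level H → T.res h x ∈ level K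
  tr_mem : ∀ {K H : Subgroup G} (h : K ≤ H) (x : T.obj K), x ∈ level K → T.tr h x ∈ level H
  nm_mem : ∀ {K H : Subgroup G} (h : K ≤ H) (x : T.obj K), x ∈ level K → T.nm h x ∈ level H
  -- since `conj g` is bijective, this says that it maps `level H` onto `level (g H g⁻¹)`
  conj_mem : ∀ (g : G) {H K : Subgroup G} (h : K = conjBy g H) (x : T.obj H),
    T.conj g h x ∈ level K ↔ x ∈ level H

namespace TambaraIdeal

variable {G : Type u} [Group G] {T : TambaraFunctor.{u, v} G}

/-- Ideals are ordered by levelwise inclusion. -/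
instance : PartialOrder (TambaraIdeal T) where
  le I J := ∀ H, I.level H ≤ J.level H
  le_refl I H := le_refl _
  le_trans I J K h h' H := (h H).trans (h' H)
  le_antisymm I J h h' := TambaraIdeal.ext (funext fun H => le_antisymm (h H) (h' H))

/-- The levelwise intersection of a set of Tambara ideals. -/
def inter (X : Set (TambaraIdeal T)) : TambaraIdeal T where
  level H := sInf ((fun I : TambaraIdeal T => I.level H) '' X)
  res_mem h x hx := by
    simp only [Ideal.mem_sInf, Set.forall_mem_image] at hx ⊢
    exact fun I hI => I.res_mem h x (hx hI)
  tr_mem h x hx := by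
    simp only [Ideal.mem_sInf, Set.forall_mem_image] at hx ⊢
    exact fun I hI => I.tr_mem h x (hx hI)
  nm_mem h x hx := by
    simp only [Ideal.mem_sInf, Set.forall_mem_image] at hx ⊢
    exact fun I hI => I.nm_mem h x (hx hI)
  conj_mem g H K h x := by
    simp only [Ideal.mem_sInf, Set.forall_mem_image]
    exact forall_congr' fun I => forall_congr' fun _ => I.conj_mem g h x

theorem mem_inter {X : Set (TambaraIdeal T)} {H : Subgroup G} {x : T.obj H} :
    x ∈ (inter X).level H ↔ ∀ I ∈ X, x ∈ I.level H := by
  simp only [inter, Ideal.mem_sInf, Set.forall_mem_image]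

/-- The smallest Tambara ideal containing `X H` at level `G/H` for every `H`. -/
def span (X : ∀ H, Set (T.obj H)) : TambaraIdeal T :=
  inter {I | ∀ H, X H ⊆ I.level H}

/-- The Tambara ideal generated by a single element of `T(G/H)`. -/
def principal {H : Subgroup G} (x : T.obj H) : TambaraIdeal T :=
  inter {I | x ∈ I.level H}

/-- The unit ideal, equal to `T` at every level. -/
def unit (T : TambaraFunctor G) : TambaraIdeal T where
  level _ := ⊤
  res_mem _ _ _ := trivial
  tr_mem _ _ _ := trivial
  nm_mem _ _ _ := trivial
  conj_mem _ _ _ _ _ := Iff.rfl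

/-- The product: the Tambara ideal generated by the levelwise products of ring ideals. -/
def mul (I J : TambaraIdeal T) : TambaraIdeal T :=
  span fun H => ((I.level H * J.level H : Ideal (T.obj H)) : Set (T.obj H))

/-- The `n`-fold product `Iⁿ`. -/
def npow (I : TambaraIdeal T) : ℕ → TambaraIdeal T
  | 0 => unit T
  | n + 1 => mul (npow I n) I

/-- A Tambara ideal is proper if it does not contain `1 ∈ T(G/G)`. -/
def IsProper (I : TambaraIdeal T) : Prop := (1 : T.obj ⊤) ∉ I.level ⊤

/-- Prime Tambara ideals in the sense of Nakaoka. -/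
def IsPrime (P : TambaraIdeal T) : Prop :=
  P.IsProper ∧ ∀ I J : TambaraIdeal T, mul I J ≤ P → I ≤ P ∨ J ≤ P

/-- The underlying set at level `G/H` of the radical `√I`:
those `x` with `⟨x⟩ⁿ ⊆ I` for some `n ≥ 1`. -/
def radicalSet (I : TambaraIdeal T) (H : Subgroup G) : Set (T.obj H) :=
  {x | ∃ n : ℕ, 1 ≤ n ∧ npow (principal x) n ≤ I}

/-- `I` is radical if `I = √I`. -/
def IsRadical (I : TambaraIdeal T) : Prop :=
  ∀ H, (I.level H : Set (T.obj H)) = I.radicalSet H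

/-- The extension `φ_*(I)`, generated by the subsets `φ_H(I(G/H))`. -/
def extend {S : TambaraFunctor.{u, w} G} (φ : TambaraHom T S) (I : TambaraIdeal T) : TambaraIdeal S :=
  span fun H => φ.app H '' (I.level H : Set (T.obj H))

theorem subset_radicalSet (I : TambaraIdeal T) (H : Subgroup G) :
    (I.level H : Set (T.obj H)) ⊆ I.radicalSet H := by
  intro x hx
  have hP : principal x ≤ I := fun L z hz => mem_inter.1 hz I hx
  have h1 : npow (principal x) 1 ≤ I := by
    intro K y hy
    exact mem_inter.1 hy I fun L z hz => hP L (Ideal.mul_le_right hz)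
  exact ⟨1, le_rfl, h1⟩

theorem inter_isRadical (X : Set (TambaraIdeal T)) (hX : ∀ I ∈ X, I.IsRadical) :
    (inter X).IsRadical := by
  intro H
  refine Set.Subset.antisymm (subset_radicalSet _ H) ?_
  rintro x ⟨n, hn, hx⟩
  refine mem_inter.2 fun I hI => ?_
  have : x ∈ I.radicalSet H := ⟨n, hn, fun K y hy => mem_inter.1 (hx K hy) I hI⟩
  rwa [← hX I hI H] at this

end TambaraIdeal

section Spectrum

variable {G : Type u} [Group G]

/-- `RadId_G(T)`: the radical Tambara ideals of `T`, ordered by inclusion. -/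
def RadId (T : TambaraFunctor.{u, v} G) : Type _ := {I : TambaraIdeal T // I.IsRadical}

instance (T : TambaraFunctor.{u, v} G) : PartialOrder (RadId T) :=
  inferInstanceAs (PartialOrder {I : TambaraIdeal T // I.IsRadical})

instance (T : TambaraFunctor.{u, v} G) : InfSet (RadId T) where
  sInf X := ⟨TambaraIdeal.inter (Subtype.val '' X),
    TambaraIdeal.inter_isRadical _ (by rintro _ ⟨I, -, rfl⟩; exact I.2)⟩

/-- The lattice structure determined by inclusion; infima are levelwise intersections. -/
instance (T : TambaraFunctor.{u, v} G) : CompleteLattice (RadId T) :=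
  completeLatticeOfInf (RadId T) fun X => by
    constructor
    · intro I hI H x hx
      exact TambaraIdeal.mem_inter.1 hx I.1 ⟨I, hI, rfl⟩
    · intro J hJ H x hx
      refine TambaraIdeal.mem_inter.2 ?_
      rintro _ ⟨I, hI, rfl⟩
      exact hJ hI H hx

/-- The frame law: binary meets distribute over arbitrary joins. -/
def IsFrame (A : Type*) [CompleteLattice A] : Prop :=
  ∀ (a : A) (X : Set A), a ⊓ sSup X = ⨆ b ∈ X, a ⊓ b

/-- The Nakaoka spectrum: the set of prime Tambara ideals. -/
def NakaokaSpectrum (T : TambaraFunctor.{u, v} G) : Type _ := {P : TambaraIdeal T // P.IsPrime}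

/-- The topology for which the sets `{P | x ∈ P(G/H)}` are a subbasis of the closed sets. -/
instance (T : TambaraFunctor.{u, v} G) : TopologicalSpace (NakaokaSpectrum T) :=
  TopologicalSpace.generateFrom
    {U | ∃ (H : Subgroup G) (x : T.obj H), U = {P : NakaokaSpectrum T | x ∈ P.1.level H}ᶜ}

end Spectrum

/-! The radical √I is the intersection of the primes containing I (`mem_radicalSet_iff`), so radical
ideals can be compared by the primes above them. A prime contains a join iff it contains every
member, and a meet iff it contains one of the two; the frame law is then propositional logic. As
√(φ_* I) ⊆ Q iff I ⊆ φ⁻¹(Q), the frame homomorphism and the induced map on spectra follow once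
φ⁻¹(Q) is prime. A point p of the frame comes from the largest radical ideal on which p is 0, and
that ideal is prime.

The difficulty is that products are defined by generation while norms are not additive. The key is
`mul_gen_le_iff`: ⟨A⟩⟨B⟩ ⊆ P iff yz ∈ P for all translates y of a ∈ A and z of b ∈ B at a common
level, a translate being a norm of a restriction of a conjugate. The elements multiplying all
translates of b into P are closed under transfer by Frobenius reciprocity. Inside such a family, the
elements all of whose translates stay in it form a Tambara ideal, `core`; additivity there rests on
Tambara reciprocity and induction on the order of the subgroup.

As G is finite, an element has finitely many translates. Hence powers of principal ideals are
finitely generated, which makes Zorn's lemma yield primes and makes basic opens compact, and two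
basic opens meet in a finite union of basic opens. -/

section Conjugation

variable {G : Type*} [Group G]

theorem conjBy_one (H : Subgroup G) : conjBy 1 H = H := by
  ext x
  simp [conjBy]

theorem conjBy_mul (g k : G) (H : Subgroup G) : conjBy (g * k) H = conjBy g (conjBy k H) := by
  ext x
  simp [conjBy, Subgroup.mem_map, mul_assoc]

theorem conjBy_mono (g : G) {K H : Subgroup G} (h : K ≤ H) : conjBy g K ≤ conjBy g H :=
  Subgroup.map_mono h

theorem eq_conjBy_inv {g : G} {H K : Subgroup G} (h : K = conjBy g H) : H = conjBy g⁻¹ K := by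
  rw [h, ← conjBy_mul, inv_mul_cancel, conjBy_one]

theorem card_conjBy (g : G) (H : Subgroup G) : Nat.card (conjBy g H) = Nat.card H :=
  (Nat.card_congr (H.equivMapOfInjective _ (MulAut.conj g).injective).toEquiv).symm

end Conjugation

theorem dvd_finprod_of_finite {ι M : Type*} [Finite ι] [CommMonoid M] (f : ι → M) (i : ι) :
    f i ∣ ∏ᶠ j, f j := by
  have := Fintype.ofFinite ι
  rw [finprod_eq_prod_of_fintype]
  exact Finset.dvd_prod_of_mem f (Finset.mem_univ i)

/-! ### Translates of an element -/

namespace TambaraFunctor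

variable {G : Type u} [Group G] {T : TambaraFunctor.{u, v} G}

theorem conj_one_apply {H : Subgroup G} (h : H = conjBy 1 H) (x : T.obj H) : T.conj 1 h x = x :=
  T.conj_id H 1 H.one_mem h x

theorem conj_conj_inv (g : G) {H K : Subgroup G} (h : K = conjBy g H) (h' : H = conjBy g⁻¹ K)
    (x : T.obj K) : T.conj g h (T.conj g⁻¹ h' x) = x := by
  rw [T.conj_conj g g⁻¹ h' h (by simp [conjBy_one])]
  exact T.conj_id K _ (by simp) _ x

/-- `y` is obtained from `x` by a conjugation, a restriction and a norm. -/
def IsTranslate {H L : Subgroup G} (x : T.obj H) (y : T.obj L) : Prop :=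
  ∃ (g : G) (K M : Subgroup G) (hM : M = conjBy g H) (hK : K ≤ M) (hL : K ≤ L),
    y = T.nm hL (T.res hK (T.conj g hM x))

theorem IsTranslate.refl {H : Subgroup G} (x : T.obj H) : IsTranslate x x :=
  ⟨1, H, H, (conjBy_one H).symm, le_rfl, le_rfl, by rw [conj_one_apply, T.res_id, T.nm_id]⟩

theorem IsTranslate.nm {H L K : Subgroup G} {x : T.obj H} {y : T.obj L} (h : IsTranslate x y)
    (hL : L ≤ K) : IsTranslate x (T.nm hL y) := by
  obtain ⟨g, K', M, hM, hK, hL', rfl⟩ := h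
  exact ⟨g, K', M, hM, hK, hL'.trans hL, by rw [T.nm_nm]⟩

theorem IsTranslate.conj {H L K : Subgroup G} {x : T.obj H} {y : T.obj L} (h : IsTranslate x y)
    (k : G) (hK : K = conjBy k L) : IsTranslate x (T.conj k hK y) := by
  obtain ⟨g, K', M, hM, hK', hL', rfl⟩ := h
  refine ⟨k * g, conjBy k K', conjBy k M, ?_, conjBy_mono k hK', ?_, ?_⟩
  · rw [hM, conjBy_mul]
  · rw [hK]; exact conjBy_mono k hL'
  · rw [T.conj_nm k hL' (by rw [hK]; exact conjBy_mono k hL') rfl hK,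
      T.conj_res k hK' (conjBy_mono k hK') rfl rfl, T.conj_conj]

theorem isTranslate_of_conj {H L K : Subgroup G} (x : T.obj H) {y : T.obj L} (k : G)
    (hK : K = conjBy k H) (h : IsTranslate (T.conj k hK x) y) : IsTranslate x y := by
  obtain ⟨g, K', M, hM, hK', hL', rfl⟩ := h
  have hM' : M = conjBy (g * k) H := by rw [hM, hK, conjBy_mul]
  exact ⟨g * k, K', M, hM', hK', hL', by rw [T.conj_conj g k hK hM hM']⟩

theorem isTranslate_of_res {H L K : Subgroup G} (x : T.obj H) {y : T.obj L}
    (hK : K ≤ H) (h : IsTranslate (T.res hK x) y) : IsTranslate x y := by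
  obtain ⟨g, K', M, hM, hK', hL', rfl⟩ := h
  subst hM
  exact ⟨g, K', conjBy g H, rfl, hK'.trans (conjBy_mono g hK), hL', by
    rw [T.conj_res g hK (conjBy_mono g hK) rfl rfl, T.res_res]⟩

section Finite

variable [Finite G]

/-- Up to multiples, restriction maps translates to translates. -/
theorem IsTranslate.res {H L K : Subgroup G} {x : T.obj H} {y : T.obj L} (h : IsTranslate x y)
    (hK : K ≤ L) : ∃ z : T.obj K, IsTranslate x z ∧ z ∣ T.res hK y := by
  obtain ⟨g, K', M, hM, hK', hL', rfl⟩ := h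
  subst hM
  rw [T.res_nm]
  -- The double coset formula makes the restriction a product; any one factor serves, and the double
  -- coset of 1 is always available.
  refine ⟨_, ?_, dvd_finprod_of_finite _ (Quotient.mk'' 1)⟩
  set q : DoubleCosets K L K' := Quotient.mk'' 1
  apply IsTranslate.nm
  exact ⟨(q.rep : G) * g, _, conjBy (q.rep : G) (conjBy g H), (conjBy_mul _ _ _).symm,
    inf_le_right.trans (conjBy_mono _ hK'), le_rfl, by
      rw [T.nm_id, T.conj_res _ hK' (conjBy_mono _ hK') rfl rfl, T.res_res,
        T.conj_conj _ _ rfl rfl (conjBy_mul _ _ _).symm]⟩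

/-- A translate of a norm of `x` is a multiple of a translate of `x`. -/
theorem IsTranslate.exists_dvd_of_nm {H L K : Subgroup G} {x : T.obj H} {hK : H ≤ K} {y : T.obj L}
    (h : IsTranslate (T.nm hK x) y) : ∃ z : T.obj L, IsTranslate x z ∧ z ∣ y := by
  obtain ⟨g, K', M, hM, hK', hL', rfl⟩ := h
  obtain ⟨z, hz, hd⟩ := (((IsTranslate.refl x).nm hK).conj g hM).res hK'
  exact ⟨_, hz.nm hL', map_dvd (T.nm hL') hd⟩

/-- Tambara reciprocity for sums, read modulo ideals closed under transfer. -/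
theorem nm_add_mem {Q : ∀ H, Ideal (T.obj H)}
    (hQ : ∀ {K H : Subgroup G} (h : K ≤ H) (x : T.obj K), x ∈ Q K → T.tr h x ∈ Q H)
    {H K : Subgroup G} (h : H ≤ K) (a b : T.obj H)
    (ha : ∀ (g : G) (S L : Subgroup G) (hL : L ≤ conjBy g H) (hS : L ≤ S),
      T.nm hS (T.res hL (T.conj g rfl a)) ∈ Q S)
    (hb : ∀ (g : G) (S L : Subgroup G) (hL : L ≤ conjBy g H) (hS : L ≤ S),
      T.nm hS (T.res hL (T.conj g rfl b)) ∈ Q S) :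
    T.nm h (a + b) ∈ Q K := by
  rw [T.nm_add]
  refine finsum_induction (· ∈ Q K) (Q K).zero_mem (fun _ _ => (Q K).add_mem) fun o => hQ _ _ ?_
  -- Each summand is the transfer of a product, so one factor in `Q` suffices. The factor at the
  -- double coset of 1 comes from `a` or from `b`, according to the colour of that coset.
  refine Ideal.mem_of_dvd _ (dvd_finprod_of_finite _ (Quotient.mk'' 1)) ?_
  cases (Quotient.out o : CosetColoring H K) (QuotientGroup.mk (DoubleCosets.rep
    (Quotient.mk'' 1 : DoubleCosets (stabIn K (Quotient.out o)) K H)))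
  · exact hb _ _ _ _ _
  · exact ha _ _ _ _ _

/-- Tambara reciprocity for transfers, read modulo ideals closed under transfer. -/
theorem nm_tr_mem {Q : ∀ H, Ideal (T.obj H)}
    (hQ : ∀ {K H : Subgroup G} (h : K ≤ H) (x : T.obj K), x ∈ Q K → T.tr h x ∈ Q H)
    {L H K : Subgroup G} (hL : L ≤ H) (h : H ≤ K) (a : T.obj L)
    (ha : ∀ (S : Subgroup G) (y : T.obj S), IsTranslate a y → y ∈ Q S) :
    T.nm h (T.tr hL a) ∈ Q K := by
  rw [T.nm_tr]
  refine finsum_induction (· ∈ Q K) (Q K).zero_mem (fun _ _ => (Q K).add_mem) fun o => hQ _ _ ?_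
  refine Ideal.mem_of_dvd _ (dvd_finprod_of_finite _ (Quotient.mk'' 1)) ?_
  exact ha _ _ ⟨_, _, _, rfl, _, _, rfl⟩

end Finite

end TambaraFunctor

/-! ### The core of a family closed under transfers -/

namespace TambaraIdeal

open TambaraFunctor

variable {G : Type u} [Group G] {T : TambaraFunctor.{u, v} G}

/-- A levelwise family of ring ideals that contains a Tambara ideal and is closed under transfers
and conjugations. -/
structure IsTransferIdeal (Q : ∀ H, Ideal (T.obj H)) : Prop where
  exists_le : ∃ P : TambaraIdeal T, ∀ H, P.level H ≤ Q H
  tr_mem : ∀ {K H : Subgroup G} (h : K ≤ H) (x : T.obj K), x ∈ Q K → T.tr h x ∈ Q H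
  conj_mem : ∀ (g : G) {H K : Subgroup G} (h : K = conjBy g H) (x : T.obj H),
    x ∈ Q H → T.conj g h x ∈ Q K

variable {Q : ∀ H, Ideal (T.obj H)}

/-- All translates of `x` lie in `Q`. -/
def MemCore (Q : ∀ H, Ideal (T.obj H)) {H : Subgroup G} (x : T.obj H) : Prop :=
  ∀ (L : Subgroup G) (y : T.obj L), IsTranslate x y → y ∈ Q L

theorem MemCore.conj {H K : Subgroup G} {x : T.obj H} (hx : MemCore Q x) (g : G)
    (h : K = conjBy g H) : MemCore Q (T.conj g h x) :=
  fun L y hy => hx L y (isTranslate_of_conj x g h hy)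

theorem MemCore.res {H K : Subgroup G} {x : T.obj H} (hx : MemCore Q x) (h : K ≤ H) :
    MemCore Q (T.res h x) :=
  fun L y hy => hx L y (isTranslate_of_res x h hy)

theorem MemCore.mul_left {H : Subgroup G} {x : T.obj H} (hx : MemCore Q x) (r : T.obj H) :
    MemCore Q (r * x) := by
  rintro L _ ⟨g, K, M, hM, hK, hL, rfl⟩
  simp only [map_mul]
  exact (Q L).mul_mem_left _ (hx L _ ⟨g, K, M, hM, hK, hL, rfl⟩)

/-- Sums of transfers of elements of the core. -/
def transferCore (Q : ∀ H, Ideal (T.obj H)) (H : Subgroup G) : AddSubgroup (T.obj H) :=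
  AddSubgroup.closure {y | ∃ (K : Subgroup G) (h : K ≤ H) (x : T.obj K), MemCore Q x ∧ T.tr h x = y}

theorem MemCore.mem_transferCore {H : Subgroup G} {x : T.obj H} (hx : MemCore Q x) :
    x ∈ transferCore Q H :=
  AddSubgroup.subset_closure ⟨H, le_rfl, x, hx, T.tr_id H x⟩

theorem conj_mem_transferCore (g : G) {H K : Subgroup G} (h : K = conjBy g H) {x : T.obj H}
    (hx : x ∈ transferCore Q H) : T.conj g h x ∈ transferCore Q K := by
  induction hx using AddSubgroup.closure_induction with
  | mem x hx =>
    obtain ⟨L, hL, x, hx, rfl⟩ := hx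
    subst h
    rw [T.conj_tr g hL (conjBy_mono g hL) rfl rfl]
    exact AddSubgroup.subset_closure ⟨_, _, _, hx.conj g rfl, rfl⟩
  | zero => rw [map_zero]; exact zero_mem _
  | add x y _ _ hx hy => rw [map_add]; exact add_mem hx hy
  | neg x _ hx => rw [map_neg]; exact neg_mem hx

/-- The additive double coset formula writes a restricted transfer as a sum of transfers of
restricted conjugates, which are again core elements. -/
theorem res_mem_transferCore {H K : Subgroup G} (h : K ≤ H) {x : T.obj H}
    (hx : x ∈ transferCore Q H) : T.res h x ∈ transferCore Q K := by
  induction hx using AddSubgroup.closure_induction with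
  | mem x hx =>
    obtain ⟨L, hL, x, hx, rfl⟩ := hx
    rw [T.res_tr]
    refine finsum_induction (· ∈ transferCore Q K) (zero_mem _) (fun _ _ => add_mem) fun q => ?_
    exact AddSubgroup.subset_closure ⟨_, _, _, (hx.conj _ rfl).res _, rfl⟩
  | zero => rw [map_zero]; exact zero_mem _
  | add x y _ _ hx hy => rw [map_add]; exact add_mem hx hy
  | neg x _ hx => rw [map_neg]; exact neg_mem hx

variable [Finite G]

/-- The outer induction is on the order of `H`, the inner one on the additive closure. Reciprocity
for transfers settles generators. Reciprocity for sums leaves norms of restricted conjugates of the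
summands: if nothing is restricted the inner hypothesis applies; otherwise the subgroup is smaller
and the outer one does. -/
theorem nm_conj_mem_of_mem_transferCore (hQ : IsTransferIdeal Q) (n : ℕ) :
    ∀ {H : Subgroup G}, Nat.card H = n → ∀ {x : T.obj H}, x ∈ transferCore Q H →
    ∀ (g : G) {M L : Subgroup G} (hM : M = conjBy g H) (hL : M ≤ L),
      T.nm hL (T.conj g hM x) ∈ Q L := by
  induction n using Nat.strong_induction_on with
  | _ n ih =>
  intro H hn x hx
  induction hx using AddSubgroup.closure_induction with
  | mem x hx =>
    obtain ⟨K, hK, x, hx, rfl⟩ := hx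
    intro g M L hM hL
    subst hM
    rw [T.conj_tr g hK (conjBy_mono g hK) rfl rfl]
    exact nm_tr_mem hQ.tr_mem _ _ _ (hx.conj g rfl)
  | zero =>
    intro g M L hM hL
    -- The norm of 0 lies in every Tambara ideal, hence in the one below `Q`.
    obtain ⟨P, hP⟩ := hQ.exists_le
    rw [map_zero]
    exact hP L (P.nm_mem hL 0 (zero_mem _))
  | add x y hx' hy' hx hy =>
    intro g M L hM hL
    rw [map_add]
    have key : ∀ {z : T.obj H}, z ∈ transferCore Q H →
        (∀ (g : G) {M L : Subgroup G} (hM : M = conjBy g H) (hL : M ≤ L),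
          T.nm hL (T.conj g hM z) ∈ Q L) →
        ∀ (k : G) (S L : Subgroup G) (hL : L ≤ conjBy k M) (hS : L ≤ S),
          T.nm hS (T.res hL (T.conj k rfl (T.conj g hM z))) ∈ Q S := by
      intro z hz hz' k S L hL hS
      have e : conjBy k M = conjBy (k * g) H := by rw [hM, conjBy_mul]
      rw [T.conj_conj k g hM rfl e]
      rcases eq_or_lt_of_le hL with rfl | hlt
      · rw [T.res_id]
        exact hz' _ _ _
      · have hc : Nat.card L < n := by
          rw [← hn, ← card_conjBy (k * g) H, ← e]
          exact Set.ncard_lt_ncard (SetLike.coe_ssubset_coe.2 hlt) (Set.toFinite _)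
        have := ih _ hc rfl (res_mem_transferCore hL (conj_mem_transferCore (k * g) e hz)) 1
          (conjBy_one L).symm hS
        rwa [conj_one_apply] at this
    exact nm_add_mem hQ.tr_mem _ _ _ (key hx' hx) (key hy' hy)
  | neg x _ hx =>
    intro g M L hM hL
    rw [map_neg, ← neg_one_mul, map_mul]
    exact (Q L).mul_mem_left _ (hx g hM hL)

/-- Conjugation and restriction preserve `transferCore`, so only the final norm of a translate needs
the induction. This gives `core` its sums and transfers. -/
theorem memCore_of_mem_transferCore (hQ : IsTransferIdeal Q) {H : Subgroup G} {x : T.obj H}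
    (hx : x ∈ transferCore Q H) : MemCore Q x := by
  rintro L _ ⟨g, K, M, hM, hK, hL, rfl⟩
  have := nm_conj_mem_of_mem_transferCore hQ _ rfl
    (res_mem_transferCore hK (conj_mem_transferCore g hM hx)) 1 (conjBy_one K).symm hL
  rwa [conj_one_apply] at this

/-- The largest Tambara ideal contained in `Q`. -/
def core (hQ : IsTransferIdeal Q) : TambaraIdeal T where
  level H :=
    { carrier := {x | MemCore Q x}
      add_mem' := fun hx hy => memCore_of_mem_transferCore hQ
        (add_mem (MemCore.mem_transferCore hx) (MemCore.mem_transferCore hy))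
      zero_mem' := memCore_of_mem_transferCore hQ (zero_mem _)
      smul_mem' := fun r _ hx => MemCore.mul_left hx r }
  res_mem h _ hx := MemCore.res hx h
  tr_mem h x hx := memCore_of_mem_transferCore hQ (AddSubgroup.subset_closure ⟨_, h, x, hx, rfl⟩)
  nm_mem h x hx := fun L y hy => by
    obtain ⟨z, hz, hd⟩ := hy.exists_dvd_of_nm
    exact Ideal.mem_of_dvd _ hd (hx L z hz)
  conj_mem g H K h x := by
    refine ⟨fun hx => ?_, fun hx => MemCore.conj hx g h⟩
    have := MemCore.conj hx g⁻¹ (eq_conjBy_inv h)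
    rw [T.conj_conj g⁻¹ g h (eq_conjBy_inv h) (by simp [conjBy_one])] at this
    rwa [T.conj_id H _ (by simp)] at this

/-- The elements that multiply all translates of `b` into `P`. -/
def colon (P : TambaraIdeal T) {M : Subgroup G} (b : T.obj M) (H : Subgroup G) : Ideal (T.obj H) where
  carrier := {y | ∀ z, IsTranslate b z → y * z ∈ P.level H}
  add_mem' hx hy z hz := by rw [add_mul]; exact add_mem (hx z hz) (hy z hz)
  zero_mem' z _ := by rw [zero_mul]; exact zero_mem _
  smul_mem' r x hx z hz := by
    rw [smul_eq_mul, mul_assoc]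
    exact Ideal.mul_mem_left _ _ (hx z hz)

/-- By Frobenius reciprocity, a transfer times a translate z is the transfer of a product with the
restriction of z, and that restriction is a multiple of a translate. -/
theorem isTransferIdeal_colon (P : TambaraIdeal T) {M : Subgroup G} (b : T.obj M) :
    IsTransferIdeal (colon P b) where
  exists_le := ⟨P, fun _ _ hx _ _ => Ideal.mul_mem_right _ _ hx⟩
  tr_mem h x hx z hz := by
    rw [mul_comm, ← T.frobenius]
    obtain ⟨z', hz', d, hd⟩ := hz.res h
    refine P.tr_mem h _ ?_
    rw [hd, mul_comm, ← mul_assoc]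
    exact Ideal.mul_mem_right _ _ (hx z' hz')
  conj_mem g H K h x hx z hz := by
    have := (P.conj_mem g h _).2 (hx _ (hz.conj g⁻¹ (eq_conjBy_inv h)))
    rwa [map_mul, conj_conj_inv] at this

end TambaraIdeal

/-! ### Generated ideals, their products and powers -/

namespace TambaraIdeal

open TambaraFunctor

variable {G : Type u} [Group G] {T : TambaraFunctor.{u, v} G}

theorem mem_of_isTranslate (P : TambaraIdeal T) {H L : Subgroup G} {x : T.obj H} {y : T.obj L}
    (h : IsTranslate x y) (hx : x ∈ P.level H) : y ∈ P.level L := by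
  obtain ⟨g, K, M, hM, hK, hL, rfl⟩ := h
  exact P.nm_mem _ _ (P.res_mem _ _ ((P.conj_mem g hM x).2 hx))

/-- The Tambara ideal generated by a set of elements of arbitrary levels. -/
def gen (F : Set (Σ H, T.obj H)) : TambaraIdeal T :=
  inter {I | ∀ a ∈ F, a.2 ∈ I.level a.1}

theorem gen_le_iff {F : Set (Σ H, T.obj H)} {P : TambaraIdeal T} :
    gen F ≤ P ↔ ∀ a ∈ F, a.2 ∈ P.level a.1 :=
  ⟨fun h a ha => h _ (mem_inter.2 fun _ hI => hI a ha), fun h _ _ hx => mem_inter.1 hx P h⟩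

theorem subset_gen {F : Set (Σ H, T.obj H)} {a : Σ H, T.obj H} (ha : a ∈ F) :
    a.2 ∈ (gen F).level a.1 :=
  gen_le_iff.1 le_rfl a ha

/-- All elements of a Tambara ideal. -/
def elements (I : TambaraIdeal T) : Set (Σ H, T.obj H) := {a | a.2 ∈ I.level a.1}

theorem gen_elements (I : TambaraIdeal T) : gen I.elements = I :=
  le_antisymm (gen_le_iff.2 fun _ ha => ha) fun H x hx => subset_gen (a := ⟨H, x⟩) hx

theorem principal_eq_gen {H : Subgroup G} (x : T.obj H) :
    principal x = gen {(⟨H, x⟩ : Σ H, T.obj H)} := by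
  simp [principal, gen]

theorem principal_le_iff {H : Subgroup G} {x : T.obj H} {P : TambaraIdeal T} :
    principal x ≤ P ↔ x ∈ P.level H := by
  rw [principal_eq_gen, gen_le_iff]
  simp

theorem span_le_iff {X : ∀ H, Set (T.obj H)} {P : TambaraIdeal T} :
    span X ≤ P ↔ ∀ H, X H ⊆ P.level H :=
  ⟨fun h H _ hx => h H (mem_inter.2 fun _ hI => hI H hx), fun h _ _ hx => mem_inter.1 hx P h⟩

theorem mul_le_iff {A B P : TambaraIdeal T} :
    mul A B ≤ P ↔ ∀ H, ∀ a ∈ A.level H, ∀ b ∈ B.level H, a * b ∈ P.level H := by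
  rw [mul, span_le_iff]
  refine forall_congr' fun H => ?_
  rw [SetLike.coe_subset_coe, Ideal.mul_le]

theorem mul_mono {A B A' B' : TambaraIdeal T} (hA : A ≤ A') (hB : B ≤ B') : mul A B ≤ mul A' B' :=
  mul_le_iff.2 fun H a ha b hb => mul_le_iff.1 le_rfl H a (hA H ha) b (hB H hb)

theorem mul_le_left (A B : TambaraIdeal T) : mul A B ≤ A :=
  mul_le_iff.2 fun _ _ ha _ _ => Ideal.mul_mem_right _ _ ha

theorem mul_le_right (A B : TambaraIdeal T) : mul A B ≤ B :=
  mul_le_iff.2 fun _ _ _ _ hb => Ideal.mul_mem_left _ _ hb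

theorem unit_le_iff {P : TambaraIdeal T} : unit T ≤ P ↔ (1 : T.obj ⊤) ∈ P.level ⊤ := by
  refine ⟨fun h => h _ trivial, fun h H x _ => ?_⟩
  have := P.res_mem (le_top : H ≤ ⊤) _ h
  rw [map_one] at this
  simpa using Ideal.mul_mem_left _ x this

/-- The products of a translate of `a` and a translate of `b`. -/
def translateProducts (a b : Σ H, T.obj H) : Set (Σ H, T.obj H) :=
  {c | ∃ (L : Subgroup G) (y z : T.obj L), IsTranslate a.2 y ∧ IsTranslate b.2 z ∧ c = ⟨L, y * z⟩}

theorem mem_of_mem_translateProducts {P : TambaraIdeal T} {a b c : Σ H, T.obj H}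
    (hc : c ∈ translateProducts a b) (h : a.2 ∈ P.level a.1 ∨ b.2 ∈ P.level b.1) :
    c.2 ∈ P.level c.1 := by
  obtain ⟨L, y, z, hy, hz, rfl⟩ := hc
  rcases h with h | h
  · exact Ideal.mul_mem_right _ _ (mem_of_isTranslate P hy h)
  · exact Ideal.mul_mem_left _ _ (mem_of_isTranslate P hz h)

section Finite

variable [Finite G]

/-- The product of two generated ideals is controlled by products of translates of generators. -/
theorem mul_gen_le_iff {A B : Set (Σ H, T.obj H)} {P : TambaraIdeal T} :
    mul (gen A) (gen B) ≤ P ↔ ∀ a ∈ A, ∀ b ∈ B, ∀ (L : Subgroup G) (y z : T.obj L),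
      IsTranslate a.2 y → IsTranslate b.2 z → y * z ∈ P.level L := by
  constructor
  · intro h a ha b hb L y z hy hz
    exact mul_le_iff.1 h L y (mem_of_isTranslate _ hy (subset_gen ha)) z
      (mem_of_isTranslate _ hz (subset_gen hb))
  · intro h
    -- Two passes: with a generator b fixed, a spreads from `A` to `gen A`; then, with any such a
    -- fixed, b spreads from `B` to `gen B`.
    have h1 : ∀ b ∈ B, gen A ≤ core (isTransferIdeal_colon P b.2) := fun b hb =>
      gen_le_iff.2 fun a ha L y hy z hz => h a ha b hb L y z hy hz
    have h2 : ∀ a ∈ (gen A).elements, gen B ≤ core (isTransferIdeal_colon P a.2) := fun a ha =>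
      gen_le_iff.2 fun b hb L z hz y hy => by
        rw [mul_comm]
        exact h1 b hb a.1 ha L y hy z hz
    refine mul_le_iff.2 fun H a ha b hb => ?_
    rw [mul_comm]
    exact h2 ⟨H, a⟩ ha H hb H b (IsTranslate.refl b) a (IsTranslate.refl a)

theorem finite_setOf_isTranslate {H : Subgroup G} (x : T.obj H) (L : Subgroup G) :
    {y : T.obj L | IsTranslate x y}.Finite := by
  refine (Set.finite_range fun i : {i : G × Subgroup G // i.2 ≤ conjBy i.1 H ∧ i.2 ≤ L} =>
    T.nm i.2.2 (T.res i.2.1 (T.conj i.1.1 rfl x))).subset ?_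
  rintro _ ⟨g, K, M, rfl, hK, hL, rfl⟩
  exact ⟨⟨(g, K), hK, hL⟩, rfl⟩

theorem finite_translateProducts (a b : Σ H, T.obj H) : (translateProducts a b).Finite := by
  refine (Set.finite_iUnion fun L : Subgroup G =>
    (finite_setOf_isTranslate a.2 L).image2 (fun y z => (⟨L, y * z⟩ : Σ H, T.obj H))
      (finite_setOf_isTranslate b.2 L)).subset ?_
  rintro _ ⟨L, y, z, hy, hz, rfl⟩
  exact Set.mem_iUnion.2 ⟨L, y, hy, z, hz, rfl⟩

theorem mul_gen (A B : Set (Σ H, T.obj H)) :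
    mul (gen A) (gen B) = gen (⋃ a ∈ A, ⋃ b ∈ B, translateProducts a b) := by
  have key : ∀ P : TambaraIdeal T, mul (gen A) (gen B) ≤ P ↔
      gen (⋃ a ∈ A, ⋃ b ∈ B, translateProducts a b) ≤ P := by
    intro P
    rw [mul_gen_le_iff, gen_le_iff]
    simp only [Set.mem_iUnion]
    constructor
    · rintro h _ ⟨a, ha, b, hb, L, y, z, hy, hz, rfl⟩
      exact h a ha b hb L y z hy hz
    · intro h a ha b hb L y z hy hz
      exact h ⟨L, y * z⟩ ⟨a, ha, b, hb, L, y, z, hy, hz, rfl⟩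
  exact le_antisymm ((key _).2 le_rfl) ((key _).1 le_rfl)

/-- Finite generation survives products because two elements have only finitely many products of
translates. -/
theorem npow_gen {A : Set (Σ H, T.obj H)} (hA : A.Finite) (n : ℕ) :
    ∃ F : Set (Σ H, T.obj H), F.Finite ∧ npow (gen A) n = gen F := by
  induction n with
  | zero =>
    refine ⟨{⟨⊤, 1⟩}, Set.finite_singleton _, le_antisymm ?_ fun _ _ _ => trivial⟩
    exact unit_le_iff.2 (subset_gen (a := ⟨⊤, 1⟩) rfl)
  | succ n ih =>
    obtain ⟨F, hF, h⟩ := ih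
    refine ⟨_, ?_, (congrArg (fun I => mul I (gen A)) h).trans (mul_gen F A)⟩
    exact hF.biUnion fun a _ => hA.biUnion fun b _ => finite_translateProducts a b

/-- Conjugation, restriction and norm are multiplicative, so a translate of ab splits into
translates of a and b. This inclusion is what splitting a power requires. -/
theorem mul_mul_le (A B C : TambaraIdeal T) : mul (mul A B) C ≤ mul A (mul B C) := by
  have h : mul A B ≤ gen {c | ∃ H, ∃ a ∈ A.level H, ∃ b ∈ B.level H, c = ⟨H, a * b⟩} :=
    mul_le_iff.2 fun H a ha b hb => subset_gen (a := ⟨H, a * b⟩) ⟨H, a, ha, b, hb, rfl⟩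
  have h' : mul (mul A B) C ≤
      mul (gen {c | ∃ H, ∃ a ∈ A.level H, ∃ b ∈ B.level H, c = ⟨H, a * b⟩}) (gen C.elements) :=
    mul_mono h (gen_elements C).ge
  refine h'.trans (mul_gen_le_iff.2 ?_)
  rintro _ ⟨H, a, ha, b, hb, rfl⟩ c hc L _ z ⟨g, K, M, hM, hK, hL, rfl⟩ hz
  simp only [map_mul]
  rw [mul_assoc]
  refine mul_le_iff.1 le_rfl L _ (mem_of_isTranslate A ⟨g, K, M, hM, hK, hL, rfl⟩ ha) _
    (mul_le_iff.1 le_rfl L _ (mem_of_isTranslate B ⟨g, K, M, hM, hK, hL, rfl⟩ hb) _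
      (mem_of_isTranslate C hz hc))

theorem npow_add_le (X : TambaraIdeal T) (n m : ℕ) :
    npow X (n + m) ≤ mul (npow X n) (npow X m) := by
  induction m with
  | zero =>
    intro H x hx
    have := mul_le_iff.1 (le_refl (mul (npow X n) (unit T))) H x hx 1 trivial
    rwa [mul_one] at this
  | succ m ih => exact (mul_mono ih le_rfl).trans (mul_mul_le _ _ _)

end Finite

/-! ### Primes and radicals -/

theorem IsPrime.isPrime_of_npow_le {P X : TambaraIdeal T} (hP : P.IsPrime) {n : ℕ}
    (h : npow X n ≤ P) : X ≤ P := by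
  induction n with
  | zero => exact absurd (unit_le_iff.1 h) hP.1
  | succ n ih => exact (hP.2 _ _ h).elim ih id

theorem IsPrime.isRadical {P : TambaraIdeal T} (hP : P.IsPrime) : P.IsRadical := fun H =>
  Set.Subset.antisymm (subset_radicalSet P H) fun _ ⟨_, _, h⟩ =>
    principal_le_iff.1 (hP.isPrime_of_npow_le h)

/-- The union of a nonempty directed set of Tambara ideals. -/
def directedUnion (c : Set (TambaraIdeal T)) (hc : DirectedOn (· ≤ ·) c) (hne : c.Nonempty) :
    TambaraIdeal T where
  level H :=
    { carrier := {x | ∃ I ∈ c, x ∈ I.level H}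
      add_mem' := by
        rintro x y ⟨I, hI, hx⟩ ⟨J, hJ, hy⟩
        obtain ⟨K, hK, hIK, hJK⟩ := hc I hI J hJ
        exact ⟨K, hK, add_mem (hIK H hx) (hJK H hy)⟩
      zero_mem' := hne.elim fun I hI => ⟨I, hI, zero_mem _⟩
      smul_mem' := fun r _ ⟨I, hI, hx⟩ => ⟨I, hI, Ideal.mul_mem_left _ r hx⟩ }
  res_mem h x := fun ⟨I, hI, hx⟩ => ⟨I, hI, I.res_mem h x hx⟩
  tr_mem h x := fun ⟨I, hI, hx⟩ => ⟨I, hI, I.tr_mem h x hx⟩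
  nm_mem h x := fun ⟨I, hI, hx⟩ => ⟨I, hI, I.nm_mem h x hx⟩
  conj_mem g _ _ h x := exists_congr fun I => and_congr_right fun _ => I.conj_mem g h x

theorem gen_le_directedUnion {c : Set (TambaraIdeal T)} {hc : DirectedOn (· ≤ ·) c}
    {hne : c.Nonempty} {F : Set (Σ H, T.obj H)} (hF : F.Finite)
    (h : gen F ≤ directedUnion c hc hne) : ∃ I ∈ c, gen F ≤ I := by
  simp only [gen_le_iff] at h ⊢
  induction F, hF using Set.Finite.induction_on with
  | empty => exact hne.elim fun I hI => ⟨I, hI, by simp⟩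
  | @insert a F _ _ ih =>
    obtain ⟨I, hI, h1⟩ := ih fun b hb => h b (Set.mem_insert_of_mem _ hb)
    obtain ⟨J, hJ, h2⟩ := h a (Set.mem_insert _ _)
    obtain ⟨K, hK, hIK, hJK⟩ := hc I hI J hJ
    exact ⟨K, hK, Set.forall_mem_insert.2 ⟨hJK _ h2, fun b hb => hIK _ (h1 b hb)⟩⟩

theorem gen_mono {A B : Set (Σ H, T.obj H)} (h : A ⊆ B) : gen A ≤ gen B :=
  gen_le_iff.2 fun _ ha => subset_gen (h ha)

theorem exists_finite_gen_le {A F : Set (Σ H, T.obj H)} (hF : F.Finite) (h : gen F ≤ gen A) :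
    ∃ B ⊆ A, B.Finite ∧ gen F ≤ gen B := by
  have hd : DirectedOn (· ≤ ·) (gen '' {B : Set (Σ H, T.obj H) | B ⊆ A ∧ B.Finite}) := by
    rintro _ ⟨B, hB, rfl⟩ _ ⟨C, hC, rfl⟩
    exact ⟨_, ⟨B ∪ C, ⟨Set.union_subset hB.1 hC.1, hB.2.union hC.2⟩, rfl⟩,
      gen_mono Set.subset_union_left, gen_mono Set.subset_union_right⟩
  have hle : gen A ≤ directedUnion _ hd ⟨_, ∅, ⟨Set.empty_subset A, Set.finite_empty⟩, rfl⟩ :=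
    gen_le_iff.2 fun a ha => ⟨gen {a},
      ⟨{a}, ⟨Set.singleton_subset_iff.2 ha, Set.finite_singleton a⟩, rfl⟩, subset_gen rfl⟩
  obtain ⟨_, ⟨B, hB, rfl⟩, hFB⟩ := gen_le_directedUnion hF (h.trans hle)
  exact ⟨B, hB.1, hB.2, hFB⟩

section Finite

variable [Finite G]

/-- Krull's argument: take P maximal among the ideals above `I` that contain no positive power of
⟨x⟩. Chains have upper bounds because these powers are finitely generated. -/
theorem exists_isPrime_of_notMem_radicalSet {I : TambaraIdeal T} {H : Subgroup G} {x : T.obj H}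
    (hx : x ∉ I.radicalSet H) : ∃ P : TambaraIdeal T, P.IsPrime ∧ I ≤ P ∧ x ∉ P.level H := by
  obtain ⟨P, hIP, hP⟩ := zorn_le_nonempty₀
    {J : TambaraIdeal T | ∀ n, 1 ≤ n → ¬ npow (principal x) n ≤ J} (fun c hcs hc J hJ => by
      refine ⟨directedUnion c hc.directedOn ⟨J, hJ⟩, fun n hn hle => ?_, fun K hK H y hy => ⟨K, hK, hy⟩⟩
      obtain ⟨F, hF, he⟩ := npow_gen (Set.finite_singleton (⟨H, x⟩ : Σ H, T.obj H)) n
      rw [← principal_eq_gen] at he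
      rw [he] at hle
      obtain ⟨K, hK, hFK⟩ := gen_le_directedUnion hF hle
      exact hcs hK n hn (he.trans_le hFK)) I fun n hn h => hx ⟨n, hn, h⟩
  have hlt : ∀ A : TambaraIdeal T, ¬ A ≤ P →
      ∃ n, 1 ≤ n ∧ npow (principal x) n ≤ gen (P.elements ∪ A.elements) := by
    intro A hA
    by_contra! h
    refine hA fun L a ha => hP.2 h (fun L y hy => ?_) L (subset_gen (a := ⟨L, a⟩) (Or.inr ha))
    exact subset_gen (a := ⟨L, y⟩) (Or.inl hy)
  refine ⟨P, ⟨fun h1 => ?_, fun A B hAB => ?_⟩, hIP, fun hxP => ?_⟩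
  · exact hP.1 1 le_rfl fun L y _ => unit_le_iff.2 h1 L trivial
  · by_contra! h
    obtain ⟨n, hn, hA⟩ := hlt A h.1
    obtain ⟨m, hm, hB⟩ := hlt B h.2
    refine hP.1 (n + m) (by omega) ((npow_add_le _ n m).trans ((mul_mono hA hB).trans ?_))
    -- Expanding (P + A)(P + B) on generators, every product has a factor in P except those from A
    -- and B, which AB ⊆ P covers.
    refine mul_gen_le_iff.2 ?_
    rintro a (ha | ha) b (hb | hb) L y z hy hz
    · exact Ideal.mul_mem_right _ _ (mem_of_isTranslate P hy ha)
    · exact Ideal.mul_mem_right _ _ (mem_of_isTranslate P hy ha)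
    · exact Ideal.mul_mem_left _ _ (mem_of_isTranslate P hz hb)
    · exact mul_le_iff.1 hAB L y (mem_of_isTranslate A hy ha) z (mem_of_isTranslate B hz hb)
  · exact hP.1 1 le_rfl ((mul_le_right _ _).trans (principal_le_iff.2 hxP))

theorem mem_radicalSet_iff {I : TambaraIdeal T} {H : Subgroup G} {x : T.obj H} :
    x ∈ I.radicalSet H ↔ ∀ P : TambaraIdeal T, P.IsPrime → I ≤ P → x ∈ P.level H := by
  refine ⟨fun ⟨n, _, h⟩ P hP hI => principal_le_iff.1 (hP.isPrime_of_npow_le (h.trans hI)),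
    fun h => ?_⟩
  by_contra hx
  obtain ⟨P, hP, hI, hxP⟩ := exists_isPrime_of_notMem_radicalSet hx
  exact hxP (h P hP hI)

/-- Elementwise form of primality. -/
theorem IsPrime.mem_or_mem {P : TambaraIdeal T} (hP : P.IsPrime) {a b : Σ H, T.obj H}
    (h : ∀ c ∈ translateProducts a b, c.2 ∈ P.level c.1) :
    a.2 ∈ P.level a.1 ∨ b.2 ∈ P.level b.1 := by
  rw [← principal_le_iff, ← principal_le_iff]
  refine hP.2 _ _ ?_
  rw [principal_eq_gen, principal_eq_gen, mul_gen]
  simpa [gen_le_iff] using h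

end Finite

/-- The levelwise preimage of a Tambara ideal. -/
def comap {S : TambaraFunctor.{u, w} G} (φ : TambaraHom T S) (Q : TambaraIdeal S) :
    TambaraIdeal T where
  level H := (Q.level H).comap (φ.app H)
  res_mem h x hx := by
    rw [Ideal.mem_comap] at hx ⊢
    rw [φ.app_res]
    exact Q.res_mem h _ hx
  tr_mem h x hx := by
    rw [Ideal.mem_comap] at hx ⊢
    rw [φ.app_tr]
    exact Q.tr_mem h _ hx
  nm_mem h x hx := by
    rw [Ideal.mem_comap] at hx ⊢
    rw [φ.app_nm]
    exact Q.nm_mem h _ hx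
  conj_mem g H K h x := by
    rw [Ideal.mem_comap, Ideal.mem_comap, φ.app_conj]
    exact Q.conj_mem g h _

theorem extend_le_iff {S : TambaraFunctor.{u, w} G} {φ : TambaraHom T S} {I : TambaraIdeal T}
    {Q : TambaraIdeal S} : extend φ I ≤ Q ↔ I ≤ comap φ Q := by
  rw [extend, span_le_iff]
  exact forall_congr' fun H => Set.image_subset_iff

theorem exists_isTranslate_of_app {S : TambaraFunctor.{u, w} G} (φ : TambaraHom T S)
    {H L : Subgroup G} {x : T.obj H} {y : S.obj L} (h : IsTranslate (φ.app H x) y) :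
    ∃ y' : T.obj L, IsTranslate x y' ∧ φ.app L y' = y := by
  obtain ⟨g, K, M, hM, hK, hL, rfl⟩ := h
  exact ⟨_, ⟨g, K, M, hM, hK, hL, rfl⟩, by rw [φ.app_nm, φ.app_res, φ.app_conj]⟩

/-- Primality is tested on elements: translates of φ(a) are images of translates of a, so the
required products already come from IJ in T. -/
theorem IsPrime.comap [Finite G] {S : TambaraFunctor.{u, w} G} (φ : TambaraHom T S)
    {Q : TambaraIdeal S} (hQ : Q.IsPrime) : (TambaraIdeal.comap φ Q).IsPrime := by
  refine ⟨fun h => hQ.1 ?_, fun I J hIJ => ?_⟩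
  · rw [← map_one (φ.app ⊤)]
    exact h
  · refine or_iff_not_imp_left.2 fun hI K b hb => ?_
    by_contra hbQ
    refine hI fun H a ha => ?_
    refine (hQ.mem_or_mem (a := ⟨H, φ.app H a⟩) (b := ⟨K, φ.app K b⟩) ?_).resolve_right hbQ
    rintro _ ⟨L, y, z, hy, hz, rfl⟩
    obtain ⟨y', hy', rfl⟩ := exists_isTranslate_of_app φ hy
    obtain ⟨z', hz', rfl⟩ := exists_isTranslate_of_app φ hz
    change φ.app L y' * φ.app L z' ∈ Q.level L
    rw [← map_mul]
    exact mul_le_iff.1 hIJ L y' (mem_of_isTranslate I hy' ha) z' (mem_of_isTranslate J hz' hb)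

end TambaraIdeal

open TambaraIdeal TopologicalSpace

/-! ### The frame of radical ideals -/

namespace RadId

variable {G : Type u} [Group G] {T : TambaraFunctor.{u, v} G}

/-- A prime Tambara ideal, as a radical ideal. -/
def ofPrime {P : TambaraIdeal T} (hP : P.IsPrime) : RadId T := ⟨P, hP.isRadical⟩

theorem le_ofPrime_iff {I : RadId T} {P : TambaraIdeal T} (hP : P.IsPrime) :
    I ≤ ofPrime hP ↔ I.1 ≤ P :=
  Iff.rfl

theorem sSup_le_prime_iff {X : Set (RadId T)} {P : TambaraIdeal T} (hP : P.IsPrime) :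
    (sSup X).1 ≤ P ↔ ∀ I ∈ X, I.1 ≤ P := by
  simp only [← le_ofPrime_iff hP, sSup_le_iff]

theorem inf_le_prime_iff {I J : RadId T} {P : TambaraIdeal T} (hP : P.IsPrime) :
    (I ⊓ J).1 ≤ P ↔ I.1 ≤ P ∨ J.1 ≤ P := by
  refine ⟨fun h => hP.2 _ _ ?_, ?_⟩
  · refine le_trans ?_ h
    -- The levelwise intersection is radical, so it lies below the lattice meet; it contains the
    -- product IJ, to which primality applies.
    have hle : (⟨inter {I.1, J.1}, inter_isRadical _ (by
        rintro K (rfl | rfl)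
        exacts [I.2, J.2])⟩ : RadId T) ≤ I ⊓ J :=
      le_inf (α := RadId T) (fun L y hy => mem_inter.1 hy _ (Or.inl rfl))
        (fun L y hy => mem_inter.1 hy _ (Or.inr rfl))
    intro H x hx
    refine hle H (mem_inter.2 ?_)
    rintro K (rfl | rfl)
    exacts [mul_le_left _ _ H hx, mul_le_right _ _ H hx]
  · rintro (h | h)
    · exact (le_ofPrime_iff hP).1 (inf_le_left.trans ((le_ofPrime_iff hP).2 h))
    · exact (le_ofPrime_iff hP).1 (inf_le_right.trans ((le_ofPrime_iff hP).2 h))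

theorem not_top_le_prime {P : TambaraIdeal T} (hP : P.IsPrime) : ¬ (⊤ : RadId T).1 ≤ P := by
  intro h
  have h' : (⟨unit T, fun H => Set.Subset.antisymm (subset_radicalSet _ H) fun _ _ => trivial⟩ :
    RadId T) ≤ ofPrime hP := (le_top (α := RadId T)).trans ((le_ofPrime_iff hP).2 h)
  exact hP.1 (h' ⊤ trivial)

variable [Finite G]

/-- A radical ideal is the intersection of the primes above it, so identities in the frame may be
checked at primes. -/
theorem le_iff_forall_isPrime {I J : RadId T} :
    I ≤ J ↔ ∀ P : TambaraIdeal T, P.IsPrime → J.1 ≤ P → I.1 ≤ P := by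
  refine ⟨fun h P _ hJ => le_trans (show I.1 ≤ J.1 from h) hJ, fun h H x hx => ?_⟩
  have : x ∈ J.1.radicalSet H := mem_radicalSet_iff.2 fun P hP hJ => h P hP hJ H hx
  rwa [← J.2 H] at this

theorem eq_of_forall_isPrime {I J : RadId T}
    (h : ∀ P : TambaraIdeal T, P.IsPrime → (I.1 ≤ P ↔ J.1 ≤ P)) : I = J :=
  le_antisymm (le_iff_forall_isPrime.2 fun P hP => (h P hP).2)
    (le_iff_forall_isPrime.2 fun P hP => (h P hP).1)

theorem isFrame : IsFrame (RadId T) := by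
  intro a X
  refine le_antisymm ?_ iSup_inf_le_inf_sSup
  refine le_iff_forall_isPrime.2 fun P hP h => ?_
  rw [inf_le_prime_iff hP, sSup_le_prime_iff hP]
  rw [← le_ofPrime_iff hP] at h
  simp only [iSup_le_iff] at h
  refine or_iff_not_imp_left.2 fun ha b hb => ?_
  exact ((inf_le_prime_iff hP).1 (h b hb)).resolve_left ha

/-- The radical of a Tambara ideal. -/
def radical (I : TambaraIdeal T) : RadId T :=
  ⟨inter {P | P.IsPrime ∧ I ≤ P}, inter_isRadical _ fun _ hP => hP.1.isRadical⟩

theorem mem_radical_level {I : TambaraIdeal T} {H : Subgroup G} {x : T.obj H} :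
    x ∈ (radical I).1.level H ↔ x ∈ I.radicalSet H := by
  rw [mem_radicalSet_iff, radical, mem_inter]
  simp only [Set.mem_ofPred_eq, and_imp]

theorem le_radical (I : TambaraIdeal T) : I ≤ (radical I).1 := fun H _ hx =>
  mem_radical_level.2 (subset_radicalSet I H hx)

theorem radical_le_prime_iff {I P : TambaraIdeal T} (hP : P.IsPrime) :
    (radical I).1 ≤ P ↔ I ≤ P :=
  ⟨(le_radical I).trans, fun h _ _ hx => mem_inter.1 hx P ⟨hP, h⟩⟩

/-- The frame homomorphism `I ↦ √(φ_* I)`. -/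
def map {S : TambaraFunctor.{u, w} G} (φ : TambaraHom T S) : FrameHom (RadId T) (RadId S) where
  toFun I := radical (extend φ I.1)
  map_inf' I J := eq_of_forall_isPrime fun Q hQ => by
    rw [inf_le_prime_iff hQ]
    simp only [radical_le_prime_iff hQ, extend_le_iff]
    exact inf_le_prime_iff (hQ.comap φ)
  map_top' := eq_of_forall_isPrime fun Q hQ => by
    rw [radical_le_prime_iff hQ, extend_le_iff]
    exact iff_of_false (not_top_le_prime (hQ.comap φ)) (not_top_le_prime hQ)
  map_sSup' X := eq_of_forall_isPrime fun Q hQ => by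
    rw [radical_le_prime_iff hQ, extend_le_iff, sSup_le_prime_iff (hQ.comap φ),
      sSup_le_prime_iff hQ, Set.forall_mem_image]
    simp only [radical_le_prime_iff hQ, extend_le_iff]

theorem map_le_prime_iff {S : TambaraFunctor.{u, w} G} (φ : TambaraHom T S) {I : RadId T}
    {Q : TambaraIdeal S} (hQ : Q.IsPrime) : (map φ I).1 ≤ Q ↔ I.1 ≤ TambaraIdeal.comap φ Q :=
  (radical_le_prime_iff hQ).trans extend_le_iff

end RadId

/-! ### The spectrum: basic opens, spectrality, points -/

namespace NakaokaSpectrum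

variable {G : Type u} [Group G] {T : TambaraFunctor.{u, v} G}

/-- The primes that do not contain a given element. -/
def basicOpen (a : Σ H, T.obj H) : Set (NakaokaSpectrum T) := {P | a.2 ∉ P.1.level a.1}

theorem mem_basicOpen {a : Σ H, T.obj H} {P : NakaokaSpectrum T} :
    P ∈ basicOpen a ↔ a.2 ∉ P.1.level a.1 :=
  Iff.rfl

theorem isOpen_basicOpen (a : Σ H, T.obj H) : IsOpen (basicOpen a) :=
  isOpen_generateFrom_of_mem ⟨a.1, a.2, rfl⟩

theorem basicOpen_one : basicOpen (⟨⊤, 1⟩ : Σ H, T.obj H) = Set.univ :=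
  Set.eq_univ_of_forall fun P => P.2.1

theorem isOpen_setOf_not_le (I : TambaraIdeal T) :
    IsOpen {P : NakaokaSpectrum T | ¬ I ≤ P.1} := by
  have : {P : NakaokaSpectrum T | ¬ I ≤ P.1} = ⋃ a ∈ I.elements, basicOpen a := by
    ext P
    rw [Set.mem_ofPred_eq, ← gen_elements I, gen_le_iff, gen_elements]
    simp [mem_basicOpen]
  rw [this]
  exact isOpen_biUnion fun a _ => isOpen_basicOpen a

/-- The point of the frame of radical ideals that corresponds to a prime. -/
def toPoint (P : NakaokaSpectrum T) : Locale.PT (RadId T) where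
  toFun I := ¬ I.1 ≤ P.1
  map_inf' I J := by
    rw [RadId.inf_le_prime_iff P.2, not_or]
    rfl
  map_top' := eq_true (RadId.not_top_le_prime P.2)
  map_sSup' X := by
    rw [RadId.sSup_le_prime_iff P.2]
    simp [Prop.exists_iff]

theorem toPoint_apply (P : NakaokaSpectrum T) (I : RadId T) : toPoint P I ↔ ¬ I.1 ≤ P.1 :=
  Iff.rfl

theorem toPoint_injective : Function.Injective (toPoint : NakaokaSpectrum T → _) := by
  intro P Q h
  have key : ∀ I : RadId T, I.1 ≤ P.1 ↔ I.1 ≤ Q.1 := fun I => by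
    rw [← not_iff_not, ← toPoint_apply, ← toPoint_apply, h]
  exact Subtype.ext (le_antisymm ((key ⟨P.1, P.2.isRadical⟩).1 le_rfl)
    ((key ⟨Q.1, Q.2.isRadical⟩).2 le_rfl))

variable [Finite G]

/-- This replaces D(a) ∩ D(b) = D(ab): elements of different levels have no single product, but the
union over products of translates is finite. -/
theorem basicOpen_inter (a b : Σ H, T.obj H) :
    basicOpen a ∩ basicOpen b = ⋃ c ∈ translateProducts a b, basicOpen c := by
  ext P
  simp only [Set.mem_inter_iff, mem_basicOpen, Set.mem_iUnion, exists_prop]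
  constructor
  · rintro ⟨ha, hb⟩
    by_contra! h
    exact (P.2.mem_or_mem h).elim ha hb
  · rintro ⟨c, hc, hcP⟩
    exact ⟨fun h => hcP (mem_of_mem_translateProducts hc (Or.inl h)),
      fun h => hcP (mem_of_mem_translateProducts hc (Or.inr h))⟩

theorem exists_basicOpen_subset {U : Set (NakaokaSpectrum T)} (hU : IsOpen U)
    {P : NakaokaSpectrum T} (hP : P ∈ U) : ∃ a, P ∈ basicOpen a ∧ basicOpen a ⊆ U := by
  induction hU with
  | basic U hU =>
    obtain ⟨H, x, rfl⟩ := hU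
    exact ⟨⟨H, x⟩, hP, fun _ h => h⟩
  | univ => exact ⟨⟨⊤, 1⟩, P.2.1, Set.subset_univ _⟩
  | inter U V _ _ hU hV =>
    obtain ⟨a, ha, haU⟩ := hU hP.1
    obtain ⟨b, hb, hbV⟩ := hV hP.2
    have h : P ∈ basicOpen a ∩ basicOpen b := ⟨ha, hb⟩
    rw [basicOpen_inter] at h
    simp only [Set.mem_iUnion, exists_prop] at h
    obtain ⟨c, hc, hcP⟩ := h
    refine ⟨c, hcP, ?_⟩
    have : basicOpen c ⊆ basicOpen a ∩ basicOpen b := by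
      rw [basicOpen_inter]
      exact Set.subset_biUnion_of_mem hc
    exact this.trans (Set.inter_subset_inter haU hbV)
  | sUnion X _ ih =>
    obtain ⟨U, hU, hPU⟩ := hP
    obtain ⟨a, ha, haU⟩ := ih U hU hPU
    exact ⟨a, ha, haU.trans (Set.subset_sUnion_of_mem hU)⟩

theorem isTopologicalBasis_basicOpen :
    IsTopologicalBasis (Set.range (basicOpen : (Σ H, T.obj H) → Set (NakaokaSpectrum T))) := by
  refine isTopologicalBasis_of_isOpen_of_nhds ?_ fun P U hP hU => ?_
  · rintro _ ⟨a, rfl⟩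
    exact isOpen_basicOpen a
  · obtain ⟨a, ha, haU⟩ := exists_basicOpen_subset hU hP
    exact ⟨_, ⟨a, rfl⟩, ha, haU⟩

theorem isCompact_basicOpen (a : Σ H, T.obj H) : IsCompact (basicOpen a) := by
  refine isCompact_of_finite_subcover fun {ι} U hU hsub => ?_
  -- The cover says exactly that a lies in the radical of the ideal generated by `A`. Some power of
  -- ⟨a⟩, being finitely generated, then needs only finitely many elements of `A`, and their members
  -- of the cover suffice.
  set A : Set (Σ H, T.obj H) := {b | ∃ i, basicOpen b ⊆ U i}
  have ha : a.2 ∈ (gen A).radicalSet a.1 := mem_radicalSet_iff.2 fun P hP hle => by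
    by_contra haP
    obtain ⟨i, hi⟩ := Set.mem_iUnion.1 (hsub (show (⟨P, hP⟩ : NakaokaSpectrum T) ∈ _ from haP))
    obtain ⟨b, hb, hbU⟩ := exists_basicOpen_subset (hU i) hi
    exact hb (gen_le_iff.1 hle b ⟨i, hbU⟩)
  obtain ⟨n, hn, hle⟩ := ha
  obtain ⟨F, hF, he⟩ := npow_gen (Set.finite_singleton a) n
  rw [principal_eq_gen, he] at hle
  obtain ⟨B, hBA, hB, hFB⟩ := exists_finite_gen_le hF hle
  choose f hf using fun b : B => hBA b.2
  classical
  have := hB.fintype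
  refine ⟨Finset.univ.image f, fun P hP => ?_⟩
  by_contra hPU
  refine hP ?_
  have hBP : gen B ≤ P.1 := gen_le_iff.2 fun b hb => by
    by_contra hbP
    exact hPU (Set.mem_biUnion (x := f ⟨b, hb⟩)
      (Finset.mem_coe.2 (Finset.mem_image_of_mem f (Finset.mem_univ _))) (hf ⟨b, hb⟩ hbP))
  have := P.2.isPrime_of_npow_le (X := gen {a}) (n := n) (he ▸ hFB.trans hBP)
  exact gen_le_iff.1 this a rfl

theorem isCompact_iff_finite_iUnion {U : Set (NakaokaSpectrum T)} :
    IsCompact U ∧ IsOpen U ↔ ∃ A : Set (Σ H, T.obj H), A.Finite ∧ U = ⋃ a ∈ A, basicOpen a :=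
  isCompact_open_iff_eq_finite_iUnion_of_isTopologicalBasis _ isTopologicalBasis_basicOpen
    isCompact_basicOpen U

/-- The generic point is the intersection of all primes in `Z`: irreducibility makes it prime,
closedness puts it in `Z`. -/
theorem exists_isGenericPoint {Z : Set (NakaokaSpectrum T)} (hZ : IsIrreducible Z)
    (hc : IsClosed Z) : ∃ P, IsGenericPoint P Z := by
  set I : TambaraIdeal T := inter (Subtype.val '' Z)
  have hle : ∀ R ∈ Z, I ≤ R.1 := fun R hR H x hx => mem_inter.1 hx _ ⟨R, hR, rfl⟩
  have hex : ∀ {a : Σ H, T.obj H}, a.2 ∉ I.level a.1 → (Z ∩ basicOpen a).Nonempty := by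
    intro a ha
    by_contra h
    refine ha (mem_inter.2 ?_)
    rintro _ ⟨R, hR, rfl⟩
    by_contra haR
    exact h ⟨R, hR, haR⟩
  have hprime : I.IsPrime := by
    refine ⟨fun h => ?_, fun A B hAB => or_iff_not_imp_left.2 fun hA K b hb => ?_⟩
    · obtain ⟨R, hR⟩ := hZ.1
      exact R.2.1 (hle R hR _ h)
    · by_contra hbI
      refine hA fun H a ha => ?_
      by_contra haI
      obtain ⟨R, hR, hRa, hRb⟩ := hZ.2 _ _ (isOpen_basicOpen ⟨H, a⟩) (isOpen_basicOpen ⟨K, b⟩)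
        (hex haI) (hex hbI)
      exact (R.2.2 _ _ (hAB.trans (hle R hR))).elim (fun h => hRa (h H ha)) fun h => hRb (h K hb)
  have hmem : (⟨I, hprime⟩ : NakaokaSpectrum T) ∈ Z := by
    by_contra h
    obtain ⟨a, ha, haZ⟩ := exists_basicOpen_subset hc.isOpen_compl h
    obtain ⟨R, hR, hRa⟩ := hex ha
    exact haZ hRa hR
  refine ⟨⟨I, hprime⟩, Set.Subset.antisymm (closure_minimal (Set.singleton_subset_iff.2 hmem) hc)
    fun R hR => ?_⟩
  refine mem_closure_iff.2 fun U hU hRU => ⟨_, ?_, rfl⟩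
  obtain ⟨a, ha, haU⟩ := exists_basicOpen_subset hU hRU
  exact haU fun h => ha (hle R hR _ h)

theorem spectralSpace (T : TambaraFunctor.{u, v} G) : SpectralSpace (NakaokaSpectrum T) where
  t0 := by
    intro P Q h
    refine Subtype.ext (TambaraIdeal.ext (funext fun H => Ideal.ext fun x => ?_))
    have := h.mem_open_iff (isOpen_basicOpen ⟨H, x⟩)
    exact not_iff_not.1 this
  isCompact_univ := by
    rw [← basicOpen_one]
    exact isCompact_basicOpen _
  sober := exists_isGenericPoint
  inter_isCompact := by
    have := QuasiSeparatedSpace.of_isTopologicalBasis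
      (isTopologicalBasis_basicOpen (T := T)) fun a b => by
        rw [basicOpen_inter]
        exact (finite_translateProducts a b).isCompact_biUnion fun c _ => isCompact_basicOpen c
    exact this.inter_isCompact
  isTopologicalBasis := (PrespectralSpace.of_isTopologicalBasis' isTopologicalBasis_basicOpen
    isCompact_basicOpen).isTopologicalBasis

/-- Preservation of joins gives a largest radical ideal `J` on which `p` is false. If AB ⊆ J then √A
⊓ √B ≤ J, so preservation of meets makes `J` prime. -/
theorem toPoint_surjective : Function.Surjective (toPoint : NakaokaSpectrum T → _) := by
  intro p
  set J : RadId T := sSup {I | ¬ p I} with hJ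
  have hpJ : ¬ p J := by
    rw [hJ, map_sSup, sSup_Prop_eq]
    rintro ⟨_, ⟨I, hI, rfl⟩, h⟩
    exact hI h
  have hle : ∀ I : RadId T, I ≤ J ↔ ¬ p I :=
    fun I => ⟨fun h hp => hpJ (OrderHomClass.mono p h hp), fun h => le_sSup h⟩
  have hprime : J.1.IsPrime := by
    refine ⟨fun h => ?_, fun A B hAB => ?_⟩
    · refine (hle ⊤).1 (fun H x _ => unit_le_iff.2 h H trivial) ?_
      rw [map_top]
      trivial
    · have h : RadId.radical A ⊓ RadId.radical B ≤ J :=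
        RadId.le_iff_forall_isPrime.2 fun P hP hJP => by
          rw [RadId.inf_le_prime_iff hP, RadId.radical_le_prime_iff hP,
            RadId.radical_le_prime_iff hP]
          exact hP.2 _ _ (hAB.trans hJP)
      rw [hle, map_inf] at h
      have h' : ¬ (p (RadId.radical A) ∧ p (RadId.radical B)) := h
      rw [not_and_or, ← hle, ← hle] at h'
      exact h'.imp (RadId.le_radical A).trans (RadId.le_radical B).trans
  refine ⟨⟨J.1, hprime⟩, DFunLike.ext _ _ fun I => propext ?_⟩
  exact (not_congr (hle I)).trans not_not

/-- The spectrum is the space of points of the frame of radical ideals. -/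
noncomputable def homeoPoints (T : TambaraFunctor.{u, v} G) :
    NakaokaSpectrum T ≃ₜ Locale.PT (RadId T) :=
  (Equiv.ofBijective toPoint ⟨toPoint_injective, toPoint_surjective⟩).toHomeomorphOfContinuousOpen
    (continuous_def.2 (by
      rintro _ ⟨I, rfl⟩
      exact isOpen_setOf_not_le I.1))
    (isTopologicalBasis_basicOpen.isOpenMap_iff.2 (by
      rintro _ ⟨a, rfl⟩
      -- The image of D(a) is the open set of points that are true on √⟨a⟩.
      refine ⟨RadId.radical (gen {a}), ?_⟩
      ext p
      obtain ⟨P, rfl⟩ := toPoint_surjective p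
      rw [Set.mem_ofPred_eq, toPoint_apply, RadId.radical_le_prime_iff P.2, gen_le_iff]
      refine Iff.trans ?_ (toPoint_injective.mem_set_image (s := basicOpen a)).symm
      simp [mem_basicOpen]))

/-- The levelwise preimage of primes. -/
def comap {S : TambaraFunctor.{u, w} G} (φ : TambaraHom T S) (Q : NakaokaSpectrum S) :
    NakaokaSpectrum T :=
  ⟨TambaraIdeal.comap φ Q.1, Q.2.comap φ⟩

theorem comap_preimage_basicOpen {S : TambaraFunctor.{u, w} G} (φ : TambaraHom T S)
    (a : Σ H, T.obj H) : comap φ ⁻¹' basicOpen a = basicOpen ⟨a.1, φ.app a.1 a.2⟩ :=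
  rfl

theorem isSpectralMap_comap {S : TambaraFunctor.{u, w} G} (φ : TambaraHom T S) :
    IsSpectralMap (comap φ) where
  isOpen_preimage := (isTopologicalBasis_basicOpen.continuous_iff.2 (by
    rintro _ ⟨a, rfl⟩
    rw [comap_preimage_basicOpen]
    exact isOpen_basicOpen _)).isOpen_preimage
  isCompact_preimage_of_isOpen U ho hc := by
    obtain ⟨A, hA, rfl⟩ := isCompact_iff_finite_iUnion.1 ⟨hc, ho⟩
    simp only [Set.preimage_iUnion, comap_preimage_basicOpen]
    exact hA.isCompact_biUnion fun a _ => isCompact_basicOpen _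

end NakaokaSpectrum

theorem mainTheorem8 {G : Type u} [Group G] [Finite G]
    (T : TambaraFunctor.{u, v} G) (S : TambaraFunctor.{u, w} G) (φ : TambaraHom T S) :
    -- the ordered sets of radical ideals are frames, and the spectra are spectral spaces
    IsFrame (RadId T) ∧ IsFrame (RadId S) ∧
    SpectralSpace (NakaokaSpectrum T) ∧ SpectralSpace (NakaokaSpectrum S) ∧
    -- the frame homomorphism `Φ`, the canonical homeomorphisms with the spaces of points,
    -- and the induced map `φa` on spectra
    ∃ (Φ : FrameHom (RadId T) (RadId S))
      (eT : NakaokaSpectrum T ≃ₜ Locale.PT (RadId T))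
      (eS : NakaokaSpectrum S ≃ₜ Locale.PT (RadId S))
      (φa : NakaokaSpectrum S → NakaokaSpectrum T),
      -- `Φ I = √(φ_* I)`
      (∀ (I : RadId T) (H : Subgroup G),
        ((Φ I).1.level H : Set (S.obj H)) = (TambaraIdeal.extend φ I.1).radicalSet H) ∧
      -- the point that corresponds to a prime `P` sends `I` to `1` exactly if `I ⊄ P`
      (∀ (P : NakaokaSpectrum T) (I : RadId T), eT P I ↔ ¬ I.1 ≤ P.1) ∧
      (∀ (Q : NakaokaSpectrum S) (J : RadId S), eS Q J ↔ ¬ J.1 ≤ Q.1) ∧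
      -- `φa` is the map that `Φ` induces on points
      (∀ Q : NakaokaSpectrum S, eT (φa Q) = (eS Q).comp Φ) ∧
      IsSpectralMap φa ∧
      -- `φa` sends a prime to its levelwise preimage
      (∀ (Q : NakaokaSpectrum S) (H : Subgroup G),
        (φa Q).1.level H = (Q.1.level H).comap (φ.app H)) := by
  refine ⟨RadId.isFrame, RadId.isFrame, NakaokaSpectrum.spectralSpace T,
    NakaokaSpectrum.spectralSpace S, RadId.map φ, NakaokaSpectrum.homeoPoints T,
    NakaokaSpectrum.homeoPoints S, NakaokaSpectrum.comap φ, ?_, fun _ _ => Iff.rfl,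
    fun _ _ => Iff.rfl, ?_, NakaokaSpectrum.isSpectralMap_comap φ, fun _ _ => rfl⟩
  · exact fun I H => Set.ext fun x => RadId.mem_radical_level
  · exact fun Q => DFunLike.ext _ _ fun I =>
      propext (not_congr (RadId.map_le_prime_iff φ Q.2).symm)
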